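/- Let $X$ be a real Hausdorff topological vector space (not assumed locally convex) whose algebraic dual $X^*$ separates the points of $X$. Let $X^\#\subseteq X^*$ be a linear subspace that is closed in the weak-* topology $\sigma(X^*,X)$ and total (it separates the points of $X$), equipped with the subspace topology of $\sigma(X^*,X)$; write $p\cdot x$ for the value of $p\in X^\#$ at $x\in X$. Let $C\subseteq X$, $C\neq X$, be a closed convex cone with vertex $0$, and let $v$ be an interior point of $C$. Assume that the polar cone $C^*=\{p\in X^\# : p\cdot c\le 0 \text{ for all } c\in C\}$ is non-degenerate, i.e. $C^*\neq\{0\}$, and put $\Delta=\{p\in C^* : p\cdot v=-1\}$ with the subspace (weak-*) topology. Let $\xi$ be a correspondence that assigns to each $p\in\Delta$ a subset $\xi(p)$ of $X$, such that 1. $\xi$ is upper demicontinuous: for every open half space $V=\{x\in X : f(x)>a\}$, with $f\neq 0$ a continuous linear functional on $X$ and $a\in\mathbb{R}$, the set $\{p\in\Delta : \xi(p)\subseteq V\}$ is open in $\Delta$; 2. $\xi(p)$ is nonempty, compact and convex for every $p\in\Delta$; 3. (weak Walras law) for every $p\in\Delta$ there is $z\in\xi(p)$ with $p\cdot z\le 0$.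 Then there is a price $p^*\in\Delta$ with $\xi(p^*)\cap C\neq\emptyset$. -/

import Mathlib

open Set

namespace GNKD

/-- The algebraic dual `X*` of a real vector space `X`, with the weak-* topology `σ(X*, X)`,
i.e. the coarsest topology making every evaluation `p ↦ p x` continuous. -/
abbrev AlgDual (X : Type*) [AddCommGroup X] [Module ℝ X] : Type _ :=
  WeakBilin (LinearMap.id : Module.Dual ℝ X →ₗ[ℝ] X →ₗ[ℝ] ℝ)

/-- The duality function `(p, x) ↦ p · x`. -/
def pair {X : Type*} [AddCommGroup X] [Module ℝ X] (p : AlgDual X) (x : X) : ℝ :=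
  (LinearMap.id : Module.Dual ℝ X →ₗ[ℝ] X →ₗ[ℝ] ℝ) p x

/-- A subspace of the algebraic dual is total if it separates the points of `X`. -/
def IsTotal {X : Type*} [AddCommGroup X] [Module ℝ X] (D : Submodule ℝ (AlgDual X)) : Prop :=
  ∀ x y : X, x ≠ y → ∃ p ∈ D, pair p x ≠ pair p y

/-- The polar cone `{p ∈ D : p · c ≤ 0 for all c ∈ C}`, a subset of the space `D`, which carries
the subspace topology of `σ(X*, X)`. -/
def polarCone {X : Type*} [AddCommGroup X] [Module ℝ X] (D : Submodule ℝ (AlgDual X))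
    (C : Set X) : Set D :=
  {p | ∀ c ∈ C, pair (p : AlgDual X) c ≤ 0}

/-- The price set `Δ = {p : p in the polar cone of C, p · v = -1}`. -/
def priceSet {X : Type*} [AddCommGroup X] [Module ℝ X] (D : Submodule ℝ (AlgDual X))
    (C : Set X) (v : X) : Set D :=
  {p | p ∈ polarCone D C ∧ pair (p : AlgDual X) v = -1}

/-- An open half space: a set `{y : f y > a}` with `f` a nonzero continuous linear functional
(half spaces `{y : f y < a}` are included, by passing to `-f` and `-a`). -/
def IsOpenHalfSpace {Y : Type*} [AddCommGroup Y] [Module ℝ Y] [TopologicalSpace Y]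
    (V : Set Y) : Prop :=
  ∃ (f : Y →L[ℝ] ℝ) (a : ℝ), f ≠ 0 ∧ V = {y | a < f y}

/-- A correspondence `φ` is upper demicontinuous if `{s : φ s ⊆ V}` is open for every open half
space `V`. -/
def UpperDemicontinuous {S Y : Type*} [TopologicalSpace S] [AddCommGroup Y] [Module ℝ Y]
    [TopologicalSpace Y] (φ : S → Set Y) : Prop :=
  ∀ V : Set Y, IsOpenHalfSpace V → IsOpen {s | φ s ⊆ V}

end GNKD

/-! ### Scarf's lemma by a parity count. -/

namespace GNKD

section Scarf

variable {ι T : Type*}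

/-! Suppose every `ξ p` misses `C`. Since `C` has an interior point, Hahn–Banach separates `ξ p`
from `C` without local convexity, and the separating functional, normalised at `v`, is a price `q
p`: a weak-* closed total `D` is the whole algebraic dual. The sets `{s | q p > 0 on ξ s}` are open
by demicontinuity and cover the price set, which is weak-* compact, so finitely many of them
suffice.

Pull this finite cover back to a simplex along `w ↦ ∑ w i • q i`. By
`exists_mem_stdSimplex_of_open_cover` some `w` lies in every member whose weight `w i` is nonzero.
At the price `∑ w i • q i` every demanded `z` then has positive value, against Walras' law.

The covering lemma, which stands in for Brouwer's theorem, follows from Scarf's lemma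
`exists_colourful_room` on a fine grid. -/

theorem exists_pair_of_card_eq_card_image_add_one {α β : Type*} [DecidableEq α] [DecidableEq β]
    (f : α → β) (A : Finset α) (h : A.card = (A.image f).card + 1) :
    ∃ a ∈ A, ∃ a' ∈ A, a ≠ a' ∧
      ∀ b ∈ A, ((A.erase b).image f = A.image f ↔ b = a ∨ b = a') := by
  obtain ⟨a, ha, a', ha', hne, hf⟩ := Finset.exists_ne_map_eq_of_card_lt_of_maps_to
    (s := A) (t := A.image f) (f := f) (by omega) (fun x hx => Finset.mem_image_of_mem f hx)
  refine ⟨a, ha, a', ha', hne, fun b hb => ⟨fun hI => ?_, ?_⟩⟩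
  -- If deleting `b` keeps the image, `f` is injective on the rest, so `b` must belong to the
  -- colliding pair.
  · have hinj : Set.InjOn f (A.erase b : Finset α) := by
      rw [← Finset.card_image_iff, hI, Finset.card_erase_of_mem hb]
      omega
    by_contra hcon
    push Not at hcon
    exact hne (hinj (by simp [ha, Ne.symm hcon.1]) (by simp [ha', Ne.symm hcon.2]) hf)
  · rintro (rfl | rfl)
    · refine le_antisymm (Finset.image_subset_image (Finset.erase_subset _ _)) ?_
      intro z hz
      obtain ⟨x, hx, rfl⟩ := Finset.mem_image.1 hz
      by_cases hxb : x = b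
      · subst hxb
        exact Finset.mem_image.2 ⟨a', by simp [ha', hne.symm], hf.symm⟩
      · exact Finset.mem_image_of_mem f (by simp [hx, hxb])
    · refine le_antisymm (Finset.image_subset_image (Finset.erase_subset _ _)) ?_
      intro z hz
      obtain ⟨x, hx, rfl⟩ := Finset.mem_image.1 hz
      by_cases hxb : x = b
      · subst hxb
        exact Finset.mem_image.2 ⟨a, by simp [ha, hne], hf⟩
      · exact Finset.mem_image_of_mem f (by simp [hx, hxb])

/-- `σ` is dominant with respect to `C` if no `y` exceeds, in each of the rankings `r i` with
`i ∈ C`, the smallest member of `σ`. -/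
def IsDominant (r : ι → T → ℕ) (σ : Finset T) (C : Finset ι) : Prop :=
  ∀ y, ∃ i ∈ C, ∀ x ∈ σ, r i y ≤ r i x

theorem IsDominant.mono {r : ι → T → ℕ} {σ τ : Finset T} {C D : Finset ι}
    (h : IsDominant r σ C) (hτ : τ ⊆ σ) (hD : C ⊆ D) : IsDominant r τ D := fun y => by
  obtain ⟨i, hi, h⟩ := h y
  exact ⟨i, hD hi, fun x hx => h x (hτ hx)⟩

/-- A room is a dominant pair of sets of the same size. -/
def IsRoom (r : ι → T → ℕ) (s : Finset T × Finset ι) : Prop :=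
  IsDominant r s.1 s.2 ∧ s.1.card = s.2.card

/-- The door `d` leads to the room `s`. -/
def Adjoins (d s : Finset T × Finset ι) : Prop := d.1 ⊆ s.1 ∧ s.2 ⊆ d.2

theorem existsUnique_room_of_empty [Fintype T] [Nonempty T] {r : ι → T → ℕ}
    (hr : ∀ i, Function.Injective (r i)) (i₀ : ι) :
    ∃ s₁, ∀ s, (IsRoom r s ∧ Adjoins ((∅ : Finset T), ({i₀} : Finset ι)) s) ↔ s = s₁ := by
  obtain ⟨x₀, -, hx₀⟩ := (Finset.univ : Finset T).exists_max_image (r i₀) Finset.univ_nonempty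
  refine ⟨({x₀}, {i₀}), fun s => ⟨?_, ?_⟩⟩
  · obtain ⟨σ, C⟩ := s
    rintro ⟨⟨hd, hc⟩, -, hC⟩
    simp only at hd hc hC
    obtain ⟨i, hi, h⟩ := hd x₀
    obtain rfl : i = i₀ := Finset.mem_singleton.1 (hC hi)
    obtain rfl : C = {i} := le_antisymm hC (by simpa using hi)
    obtain ⟨x, rfl⟩ := Finset.card_eq_one.1 (hc.trans (Finset.card_singleton i))
    have := hr i (le_antisymm (h x (by simp)) (hx₀ x (Finset.mem_univ _)))
    rw [this]
  · rintro rfl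
    refine ⟨⟨fun y => ⟨i₀, by simp, fun x hx => ?_⟩, by simp⟩, by simp [Adjoins]⟩
    obtain rfl := Finset.mem_singleton.1 hx
    exact hx₀ y (Finset.mem_univ _)

variable [DecidableEq ι] [DecidableEq T]

/-- A door is a dominant pair whose colours are all the indices except `i₀`. -/
def IsDoor (r : ι → T → ℕ) (c : T → ι) (i₀ : ι) (d : Finset T × Finset ι) : Prop :=
  IsDominant r d.1 d.2 ∧ d.1.card + 1 = d.2.card ∧ i₀ ∈ d.2 ∧ d.1.image c = d.2.erase i₀

/-- The sizes satisfy `|d.1| ≤ |s.1| = |s.2| ≤ |d.2| = |d.1| + 1`, so exactly one of the two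
inclusions is an equality and the other adds one element. -/
theorem Adjoins.cases {d s : Finset T × Finset ι} (h : Adjoins d s)
    (hd : d.1.card + 1 = d.2.card) (hs : s.1.card = s.2.card) :
    (d.1 = s.1 ∧ ∃ i ∈ d.2, i ∉ s.2 ∧ s.2 = d.2.erase i ∧ d.2 = insert i s.2) ∨
    (d.2 = s.2 ∧ ∃ x ∈ s.1, x ∉ d.1 ∧ d.1 = s.1.erase x ∧ s.1 = insert x d.1) := by
  obtain ⟨h1, h2⟩ := h
  have c1 := Finset.card_le_card h1
  have c2 := Finset.card_le_card h2
  by_cases hc : s.1.card ≤ d.1.card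
  · left
    refine ⟨Finset.eq_of_subset_of_card_le h1 hc, ?_⟩
    obtain ⟨i, hi, hi'⟩ := (Finset.covBy_iff_exists_insert.1
      (Finset.covBy_iff_card_sdiff_eq_one.2 ⟨h2, by
        rw [Finset.card_sdiff_of_subset h2]; omega⟩))
    exact ⟨i, by simp [← hi'], hi, by rw [← hi', Finset.erase_insert hi], hi'.symm⟩
  · right
    refine ⟨(Finset.eq_of_subset_of_card_le h2 (by omega)).symm, ?_⟩
    obtain ⟨i, hi, hi'⟩ := (Finset.covBy_iff_exists_insert.1
      (Finset.covBy_iff_card_sdiff_eq_one.2 ⟨h1, by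
        rw [Finset.card_sdiff_of_subset h1]; omega⟩))
    exact ⟨i, by simp [← hi'], hi, by rw [← hi', Finset.erase_insert hi], hi'.symm⟩

/-- If the colours of `σ` lie in `C`, they are `C` without `i₀`, so exactly two points share a
colour, and the doors delete one of them. Otherwise a single `x` has a colour outside `C`, and the
doors either delete `x` or add its colour to `C`. -/
theorem exists_pair_doors {r : ι → T → ℕ} {c : T → ι} {i₀ : ι} {s : Finset T × Finset ι}
    (hs : IsRoom r s) (hcol : s.1.image c ≠ s.2) {d₀ : Finset T × Finset ι}
    (hd₀ : IsDoor r c i₀ d₀) (had : Adjoins d₀ s) :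
    ∃ d₁ d₂, d₁ ≠ d₂ ∧ ∀ d, (IsDoor r c i₀ d ∧ Adjoins d s) ↔ d = d₁ ∨ d = d₂ := by
  obtain ⟨σ, C⟩ := s
  obtain ⟨hdom, hcard⟩ := hs
  simp only at hdom hcard hcol
  by_cases hc : σ.image c ⊆ C
  · have key : ∀ d, IsDoor r c i₀ d → Adjoins d (σ, C) →
        d.2 = C ∧ ∃ x ∈ σ, d.1 = σ.erase x ∧ i₀ ∈ C ∧ (σ.erase x).image c = C.erase i₀ := by
      rintro ⟨τ, D⟩ ⟨-, h1, h2, h3⟩ hA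
      rcases hA.cases h1 hcard with ⟨e1, i, hi, hiC, e2, e3⟩ | ⟨e1, x, hx, -, e2, -⟩
      · simp only at *
        exfalso
        apply hcol
        apply Finset.eq_of_subset_of_card_le hc
        rw [← e1, h3, Finset.card_erase_of_mem h2, ← h1, ← hcard, e1]
        simp
      · simp only at *
        subst e1
        exact ⟨rfl, x, hx, e2, h2, e2 ▸ h3⟩
    obtain ⟨-, x, hx, -, hi₀, him⟩ := key d₀ hd₀ had
    have himσ : σ.image c = C.erase i₀ := by
      refine le_antisymm ?_ (him ▸ Finset.image_subset_image (Finset.erase_subset _ _))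
      intro j hj
      refine Finset.mem_erase.2 ⟨?_, hc hj⟩
      rintro rfl
      apply hcol
      refine le_antisymm hc ?_
      intro k hk
      by_cases hkj : k = j
      · exact hkj ▸ hj
      · have : k ∈ (σ.erase x).image c := by rw [him]; simp [hk, hkj]
        exact Finset.image_subset_image (Finset.erase_subset _ _) this
    have hCpos : 0 < C.card := Finset.card_pos.2 ⟨_, hi₀⟩
    obtain ⟨a, ha, a', ha', hne, hiff⟩ := exists_pair_of_card_eq_card_image_add_one c σ (by
      rw [himσ, Finset.card_erase_of_mem hi₀]; omega)
    rw [himσ] at hiff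
    have mk : ∀ b ∈ σ, (σ.erase b).image c = C.erase i₀ →
        IsDoor r c i₀ (σ.erase b, C) ∧ Adjoins (σ.erase b, C) (σ, C) := by
      intro b hb h
      refine ⟨⟨hdom.mono (Finset.erase_subset _ _) subset_rfl, ?_, hi₀, h⟩,
        Finset.erase_subset _ _, subset_rfl⟩
      simp only [Finset.card_erase_of_mem hb]
      omega
    refine ⟨(σ.erase a, C), (σ.erase a', C), ?_, fun d => ⟨fun h => ?_, ?_⟩⟩
    · intro h
      have h' : a' ∈ σ.erase a := by simp [ha', hne.symm]
      rw [(Prod.mk.inj h).1] at h'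
      simp at h'
    · obtain ⟨h2, y, hy, h1, -, h4⟩ := key d h.1 h.2
      rcases (hiff y hy).1 h4 with rfl | rfl
      · left; exact Prod.ext h1 h2
      · right; exact Prod.ext h1 h2
    · rintro (rfl | rfl)
      · exact mk _ ha ((hiff a ha).2 (Or.inl rfl))
      · exact mk _ ha' ((hiff a' ha').2 (Or.inr rfl))
  · obtain ⟨j, hj, hjC⟩ := Finset.not_subset.1 hc
    obtain ⟨x, hx, rfl⟩ := Finset.mem_image.1 hj
    have hpos : 0 < σ.card := Finset.card_pos.2 ⟨_, hx⟩
    have key : ∀ d, IsDoor r c i₀ d → Adjoins d (σ, C) →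
        (d = (σ.erase x, C) ∨ d = (σ, insert (c x) C)) ∧
        i₀ ∈ C ∧ (σ.erase x).image c = C.erase i₀ ∧ σ.image c = (insert (c x) C).erase i₀ := by
      rintro ⟨τ, D⟩ ⟨-, h1, h2, h3⟩ hA
      rcases hA.cases h1 hcard with ⟨e1, i, hi, hiC, e2, e3⟩ | ⟨e1, x', hx', -, e2, -⟩
      · simp only at *
        subst e1
        have hxD : c x ∈ D.erase i₀ := h3 ▸ hj
        have hxi : c x = i := by
          by_contra hne
          apply hjC
          rw [e2]
          exact Finset.mem_erase.2 ⟨hne, (Finset.mem_erase.1 hxD).2⟩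
        subst hxi
        have hne : i₀ ≠ c x := fun h => (Finset.mem_erase.1 hxD).1 h.symm
        have hi₀ : i₀ ∈ C := by rw [e2]; exact Finset.mem_erase.2 ⟨hne, h2⟩
        have hinj : Set.InjOn c (τ : Set T) := by
          rw [← Finset.card_image_iff, h3, Finset.card_erase_of_mem h2, ← h1]
          simp
        refine ⟨Or.inr (by rw [e3]), hi₀, ?_, by rw [← e3, h3]⟩
        rw [e2, Finset.erase_right_comm, ← h3]
        ext z
        simp only [Finset.mem_image, Finset.mem_erase]
        constructor
        · rintro ⟨w, ⟨hw1, hw2⟩, rfl⟩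
          exact ⟨fun h => hw1 (hinj hw2 hx h), w, hw2, rfl⟩
        · rintro ⟨hz, w, hw, rfl⟩
          exact ⟨w, ⟨fun h => hz (h ▸ rfl), hw⟩, rfl⟩
      · simp only at *
        subst e1
        have hxx : x = x' := by
          by_contra hne
          have : c x ∈ τ.image c := Finset.mem_image_of_mem c (by rw [e2]; simp [hne, hx])
          rw [h3] at this
          exact hjC (Finset.mem_erase.1 this).2
        subst hxx
        rw [e2] at h3
        refine ⟨Or.inl (by rw [e2]), h2, h3, ?_⟩
        have hne : c x ≠ i₀ := fun h => hjC (h ▸ h2)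
        rw [Finset.erase_insert_of_ne hne, ← h3, ← Finset.image_insert,
          Finset.insert_erase hx]
    obtain ⟨-, hi₀, ha, hb⟩ := key d₀ hd₀ had
    refine ⟨(σ.erase x, C), (σ, insert (c x) C), ?_, fun d => ⟨fun h => (key d h.1 h.2).1, ?_⟩⟩
    · intro h
      have := (Prod.mk.inj h).1
      rw [Finset.erase_eq_self] at this
      exact this hx
    · rintro (rfl | rfl)
      · refine ⟨⟨hdom.mono (Finset.erase_subset _ _) subset_rfl, ?_, hi₀, ha⟩,
          Finset.erase_subset _ _, subset_rfl⟩
        simp only [Finset.card_erase_of_mem hx]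
        omega
      · refine ⟨⟨hdom.mono subset_rfl (Finset.subset_insert _ _), ?_, by simp [hi₀], hb⟩,
          subset_rfl, Finset.subset_insert _ _⟩
        simp only [Finset.card_insert_of_notMem hjC]
        omega

/-- Sending an index to its minimiser in `τ` maps `D` onto `τ` by dominance, so exactly two indices
are redundant for this surjection. Freeing a redundant `l` gives one room: add the `r l`-largest
point that beats all the other minima, or drop `l` if there is no such point. -/
theorem exists_pair_rooms [Fintype T] {r : ι → T → ℕ} (hr : ∀ i, Function.Injective (r i))
    {τ : Finset T} {D : Finset ι} (hdom : IsDominant r τ D) (hcard : τ.card + 1 = D.card)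
    (hτ : τ.Nonempty) :
    ∃ s₁ s₂, s₁ ≠ s₂ ∧ ∀ s, (IsRoom r s ∧ Adjoins (τ, D) s) ↔ s = s₁ ∨ s = s₂ := by
  have hmin : ∀ i, ∃ x ∈ τ, ∀ y ∈ τ, r i x ≤ r i y := fun i => τ.exists_min_image (r i) hτ
  choose m hm hmle using hmin
  have heq : ∀ i, ∀ z ∈ τ, (∀ x ∈ τ, r i z ≤ r i x) → m i = z := fun i z hz h =>
    hr i (le_antisymm (hmle i z hz) (h _ (hm i)))
  have himD : D.image m = τ := by
    refine le_antisymm (Finset.image_subset_iff.2 fun i _ => hm i) fun z hz => ?_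
    obtain ⟨i, hi, h⟩ := hdom z
    exact Finset.mem_image.2 ⟨i, hi, heq i z hz h⟩
  -- the rooms in which the index `l` loses its minimum in `τ`
  let P : ι → Finset T × Finset ι → Prop := fun l s =>
    s = (τ, D.erase l) ∨
      ∃ x, x ∉ τ ∧ s = (insert x τ, D) ∧ ∀ k ∈ D, k ≠ l → r k (m k) < r k x
  have hP : ∀ l ∈ D, ∀ s, P l s → Adjoins (τ, D) s ∧ s.1.card = s.2.card := by
    rintro l hl s (rfl | ⟨x, hx, rfl, -⟩)
    · refine ⟨⟨subset_rfl, Finset.erase_subset _ _⟩, ?_⟩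
      simp only [Finset.card_erase_of_mem hl]
      omega
    · refine ⟨⟨Finset.subset_insert _ _, subset_rfl⟩, ?_⟩
      simp only [Finset.card_insert_of_notMem hx]
      omega
  have huniq : ∀ l ∈ D, (D.erase l).image m = τ →
      ∃ s₀, ∀ s, (IsDominant r s.1 s.2 ∧ P l s) ↔ s = s₀ := by
    intro l hl him
    by_cases hM : ∃ y, ∀ k ∈ D, k ≠ l → r k (m k) < r k y
    · obtain ⟨x₀, hx₀, hmax⟩ := (Finset.univ.filter
        fun y => ∀ k ∈ D, k ≠ l → r k (m k) < r k y).exists_max_image (r l)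
        (by obtain ⟨y, hy⟩ := hM; exact ⟨y, by simpa using hy⟩)
      simp only [Finset.mem_filter, Finset.mem_univ, true_and] at hx₀ hmax
      have hx₀τ : x₀ ∉ τ := by
        intro h
        rw [← him] at h
        obtain ⟨k, hk, rfl⟩ := Finset.mem_image.1 h
        exact lt_irrefl _ (hx₀ k (Finset.mem_of_mem_erase hk) (Finset.ne_of_mem_erase hk))
      refine ⟨(insert x₀ τ, D), fun s => ⟨?_, ?_⟩⟩
      · rintro ⟨hd, rfl | ⟨x, hx, rfl, hxM⟩⟩
        · obtain ⟨i, hi, h⟩ := hd x₀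
          have := hx₀ i (Finset.mem_of_mem_erase hi) (Finset.ne_of_mem_erase hi)
          exact absurd (h _ (hm i)) (by omega)
        · obtain ⟨i, hi, h⟩ := hd x₀
          have hil : i = l := by
            by_contra hne
            have := hx₀ i hi hne
            exact absurd (h _ (Finset.mem_insert_of_mem (hm i))) (by omega)
          subst hil
          rw [hr i (le_antisymm (h x (Finset.mem_insert_self _ _)) (hmax x hxM))]
      · rintro rfl
        refine ⟨fun y => ?_, Or.inr ⟨x₀, hx₀τ, rfl, hx₀⟩⟩
        by_cases hy : ∀ k ∈ D, k ≠ l → r k (m k) < r k y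
        · obtain ⟨i, hi, h⟩ := hdom y
          have hil : i = l := by
            by_contra hne
            have := hy i hi hne
            exact absurd (h _ (hm i)) (by omega)
          subst hil
          refine ⟨i, hi, fun x hx => ?_⟩
          rcases Finset.mem_insert.1 hx with rfl | hx
          · exact hmax y hy
          · exact h x hx
        · push Not at hy
          obtain ⟨k, hk, hkl, hle⟩ := hy
          refine ⟨k, hk, fun x hx => ?_⟩
          rcases Finset.mem_insert.1 hx with rfl | hx
          · exact hle.trans (hx₀ k hk hkl).le
          · exact hle.trans (hmle k x hx)
    · refine ⟨(τ, D.erase l), fun s => ⟨?_, ?_⟩⟩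
      · rintro ⟨-, rfl | ⟨x, -, -, hxM⟩⟩
        · rfl
        · exact absurd ⟨x, hxM⟩ hM
      · rintro rfl
        refine ⟨fun y => ?_, Or.inl rfl⟩
        push Not at hM
        obtain ⟨k, hk, hkl, hle⟩ := hM y
        exact ⟨k, Finset.mem_erase.2 ⟨hkl, hk⟩, fun x hx => hle.trans (hmle k x hx)⟩
  have hex : ∀ s, IsRoom r s → Adjoins (τ, D) s →
      ∃ l ∈ D, (D.erase l).image m = τ ∧ P l s := by
    rintro ⟨σ, C⟩ ⟨hd, hc⟩ hA
    rcases hA.cases hcard hc with ⟨e1, l, hl, -, e2, -⟩ | ⟨e1, x, -, hx, -, e2⟩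
    · simp only at *
      subst e1 e2
      refine ⟨l, hl, ?_, Or.inl rfl⟩
      refine le_antisymm (Finset.image_subset_iff.2 fun i _ => hm i) fun z hz => ?_
      obtain ⟨i, hi, h⟩ := hd z
      exact Finset.mem_image.2 ⟨i, hi, heq i z hz h⟩
    · simp only at *
      subst e1 e2
      obtain ⟨l, hl, hlx⟩ := hd x
      have hz : ∀ z ∈ τ, ∃ i ∈ D.erase l, m i = z ∧ r i z ≤ r i x := by
        intro z hz
        obtain ⟨i, hi, h⟩ := hd z
        refine ⟨i, Finset.mem_erase.2 ⟨?_, hi⟩,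
          heq i z hz fun w hw => h w (Finset.mem_insert_of_mem hw),
          h x (Finset.mem_insert_self _ _)⟩
        rintro rfl
        have := hr i (le_antisymm (h x (Finset.mem_insert_self _ _))
          (hlx z (Finset.mem_insert_of_mem hz)))
        exact hx (this ▸ hz)
      have him : (D.erase l).image m = τ := by
        refine le_antisymm (Finset.image_subset_iff.2 fun i _ => hm i) fun z hzτ => ?_
        obtain ⟨i, hi, h, -⟩ := hz z hzτ
        exact Finset.mem_image.2 ⟨i, hi, h⟩
      have hinj : Set.InjOn m (D.erase l : Finset ι) := by
        rw [← Finset.card_image_iff, him, Finset.card_erase_of_mem hl]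
        omega
      refine ⟨l, hl, him, Or.inr ⟨x, hx, rfl, fun k hk hkl => ?_⟩⟩
      obtain ⟨i, hi, hik, hle⟩ := hz (m k) (hm k)
      have : i = k := hinj hi (by simp [hk, hkl]) hik
      subst this
      exact lt_of_le_of_ne hle fun h => hx (hr i h ▸ hm i)
  obtain ⟨a, ha, a', ha', hne, hiff⟩ :=
    exists_pair_of_card_eq_card_image_add_one m D (by rw [himD]; omega)
  rw [himD] at hiff
  obtain ⟨s₁, hs₁⟩ := huniq a ha ((hiff a ha).2 (Or.inl rfl))
  obtain ⟨s₂, hs₂⟩ := huniq a' ha' ((hiff a' ha').2 (Or.inr rfl))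
  have h₁ := (hs₁ s₁).2 rfl
  have h₂ := (hs₂ s₂).2 rfl
  refine ⟨s₁, s₂, ?_, fun s => ⟨?_, ?_⟩⟩
  · rintro rfl
    rcases h₁.2 with e | ⟨x, hx, e, hxM⟩ <;> rcases h₂.2 with e' | ⟨x', hx', e', hxM'⟩
    · have := (Prod.mk.inj (e.symm.trans e')).2
      have h' : a' ∈ D.erase a := Finset.mem_erase.2 ⟨hne.symm, ha'⟩
      rw [this] at h'
      simp at h'
    · have := (Prod.mk.inj (e.symm.trans e')).1
      exact hx' (this ▸ Finset.mem_insert_self _ _)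
    · have := (Prod.mk.inj (e'.symm.trans e)).1
      exact hx (this ▸ Finset.mem_insert_self _ _)
    · have h' := (Prod.mk.inj (e.symm.trans e')).1
      have hxx : x = x' := by
        have : x ∈ insert x' τ := h' ▸ Finset.mem_insert_self _ _
        exact (Finset.mem_insert.1 this).resolve_right hx
      subst hxx
      -- A point added for both `a` and `a'` would beat every minimum, against dominance of `(τ,
      -- D)`.
      obtain ⟨i, hi, h⟩ := hdom x
      have hle := h _ (hm i)
      by_cases hia : i = a
      · have := hxM' i hi (by rw [hia]; exact hne)
        omega
      · have := hxM i hi hia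
        omega
  · rintro ⟨hs, hA⟩
    obtain ⟨l, hl, him, hPl⟩ := hex s hs hA
    rcases (hiff l hl).1 him with rfl | rfl
    · exact Or.inl ((hs₁ s).1 ⟨hs.1, hPl⟩)
    · exact Or.inr ((hs₂ s).1 ⟨hs.1, hPl⟩)
  · rintro (rfl | rfl)
    · exact ⟨⟨h₁.1, (hP a ha _ h₁.2).2⟩, (hP a ha _ h₁.2).1⟩
    · exact ⟨⟨h₂.1, (hP a' ha' _ h₂.2).2⟩, (hP a' ha' _ h₂.2).1⟩

/-- **Scarf's lemma**: every colouring of a finite set with finitely many rankings admits a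
dominant pair `(σ, C)` in which `σ` carries exactly the colours in `C`. -/
theorem exists_colourful_room [Fintype ι] [Nonempty ι] [Fintype T] [Nonempty T] {r : ι → T → ℕ}
    (hr : ∀ i, Function.Injective (r i)) (c : T → ι) :
    ∃ σ C, IsDominant r σ C ∧ σ.image c = C := by
  classical
  obtain ⟨i₀⟩ := ‹Nonempty ι›
  by_contra hcon
  push Not at hcon
  let rooms : Finset (Finset T × Finset ι) := Finset.univ.filter (IsRoom r)
  let doors : Finset (Finset T × Finset ι) := Finset.univ.filter (IsDoor r c i₀)
  -- Count incidences twice. Without a colourful room, each room has zero or two doors; each door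
  -- leads to two rooms, except `(∅, {i₀})`, which leads to one.
  have hdc := Finset.sum_card_bipartiteAbove_eq_sum_card_bipartiteBelow
    (s := doors) (t := rooms) Adjoins
  have heven : Even (∑ s ∈ rooms, (doors.bipartiteBelow Adjoins s).card) := by
    refine Finset.even_sum _ fun s hs => ?_
    have hs : IsRoom r s := by simpa [rooms] using hs
    rcases (doors.bipartiteBelow Adjoins s).eq_empty_or_nonempty with h | ⟨d, hd⟩
    · simp [h]
    · simp only [Finset.bipartiteBelow, doors, Finset.mem_filter, Finset.mem_univ, true_and] at hd
      obtain ⟨d₁, d₂, hne, h⟩ := exists_pair_doors hs (hcon _ _ hs.1) hd.1 hd.2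
      have : doors.bipartiteBelow Adjoins s = {d₁, d₂} := by
        ext d
        simp [Finset.bipartiteBelow, doors, h]
      rw [this, Finset.card_pair hne]
      exact even_two
  rw [← hdc] at heven
  have hmem : ((∅ : Finset T), ({i₀} : Finset ι)) ∈ doors := by
    simp only [doors, Finset.mem_filter, Finset.mem_univ, true_and]
    exact ⟨fun y => ⟨i₀, by simp, by simp⟩, by simp, by simp, by simp⟩
  rw [← Finset.add_sum_erase _ _ hmem] at heven
  have hone : (rooms.bipartiteAbove Adjoins ((∅ : Finset T), ({i₀} : Finset ι))).card = 1 := by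
    obtain ⟨s₁, h⟩ := existsUnique_room_of_empty hr i₀
    rw [Finset.card_eq_one]
    refine ⟨s₁, ?_⟩
    ext s
    simp [Finset.bipartiteAbove, rooms, h]
  have hrest : Even (∑ d ∈ doors.erase ((∅ : Finset T), ({i₀} : Finset ι)),
      (rooms.bipartiteAbove Adjoins d).card) := by
    refine Finset.even_sum _ fun d hd => ?_
    obtain ⟨hne, hd⟩ := Finset.mem_erase.1 hd
    obtain ⟨τ, D⟩ := d
    have hd : IsDoor r c i₀ (τ, D) := by simpa [doors] using hd
    obtain ⟨hd1, hd2, hd3, hd4⟩ := hd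
    have hτ : τ.Nonempty := by
      rw [Finset.nonempty_iff_ne_empty]
      rintro rfl
      apply hne
      obtain ⟨j, rfl⟩ := Finset.card_eq_one.1 hd2.symm
      rw [Finset.mem_singleton.1 hd3]
    obtain ⟨s₁, s₂, hne, h⟩ := exists_pair_rooms hr hd1 hd2 hτ
    have : rooms.bipartiteAbove Adjoins (τ, D) = {s₁, s₂} := by
      ext s
      simp [Finset.bipartiteAbove, rooms, h]
    rw [this, Finset.card_pair hne]
    exact even_two
  rw [hone, Nat.even_add] at heven
  exact absurd (heven.2 hrest) (by decide)

end Scarf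

end GNKD

/-! ### A covering lemma on the simplex. -/

namespace GNKD

/-- If open sets `U i` cover the standard simplex, some point of the simplex lies in every `U i`
for which its `i`-th coordinate does not vanish. -/
theorem exists_mem_stdSimplex_of_open_cover {ι : Type*} [Fintype ι] [Nonempty ι]
    (U : ι → Set (ι → ℝ)) (hU : ∀ i, IsOpen (U i)) (hcov : stdSimplex ℝ ι ⊆ ⋃ i, U i) :
    ∃ w ∈ stdSimplex ℝ ι, ∀ i, w i ≠ 0 → w ∈ U i := by
  classical
  obtain ⟨δ, hδ, hleb⟩ := lebesgue_number_lemma_of_metric (isCompact_stdSimplex ℝ ι) hU hcov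
  set n := Fintype.card ι with hn
  -- Grid points have denominator `N`; numerators differing by at most `n` then give coordinates
  -- less than `δ` apart.
  obtain ⟨N, hN⟩ := exists_nat_gt ((n : ℝ) / δ)
  have hnpos : 0 < n := Fintype.card_pos
  have hNpos : (0 : ℝ) < N := lt_of_le_of_lt (by positivity) hN
  let T := {x : ι → Fin (N + 1) // ∑ i, (x i : ℕ) = N}
  obtain ⟨e⟩ := Fintype.truncEquivFin T |>.nonempty
  set K := Fintype.card T with hK
  have mkT : ∀ y : ι → ℕ, ∑ i, y i = N → ∃ x : T, ∀ i, ((x.1 i : Fin (N + 1)) : ℕ) = y i := by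
    intro y hy
    have hle : ∀ i, y i < N + 1 := fun i =>
      Nat.lt_succ_of_le (hy ▸ Finset.single_le_sum (f := y) (fun _ _ => Nat.zero_le _)
        (Finset.mem_univ i))
    exact ⟨⟨fun i => ⟨y i, hle i⟩, hy⟩, fun i => rfl⟩
  have hTne : Nonempty T := by
    obtain ⟨i₀⟩ := ‹Nonempty ι›
    obtain ⟨x, -⟩ := mkT (fun i => if i = i₀ then N else 0) (by simp)
    exact ⟨x⟩
  -- Rank by the `i`-th coordinate, breaking ties by the enumeration `e`, whose values are below
  -- `K`.
  let r : ι → T → ℕ := fun i x => (x.1 i : ℕ) * K + (e x : ℕ)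
  have hr_le : ∀ i x y, r i x ≤ r i y → (x.1 i : ℕ) ≤ y.1 i := by
    intro i x y h
    by_contra! hlt
    have h1 : ((y.1 i : ℕ) + 1) * K ≤ (x.1 i : ℕ) * K := Nat.mul_le_mul_right _ hlt
    have h2 := (e y).2
    simp only [r] at h
    rw [add_mul, one_mul] at h1
    omega
  have hr : ∀ i, Function.Injective (r i) := by
    intro i x y h
    have h1 := le_antisymm (hr_le i x y h.le) (hr_le i y x h.ge)
    simp only [r, h1] at h
    exact e.injective (Fin.ext (by omega))
  have hpt : ∀ x : T, (fun i => ((x.1 i : ℕ) : ℝ) / N) ∈ stdSimplex ℝ ι := by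
    intro x
    refine ⟨fun i => by positivity, ?_⟩
    rw [← Finset.sum_div, div_eq_one_iff_eq hNpos.ne']
    exact_mod_cast x.2
  have hcol : ∀ x : T, ∃ i, Metric.ball (fun i => ((x.1 i : ℕ) : ℝ) / N) δ ⊆ U i := fun x =>
    hleb _ (hpt x)
  choose c hc using hcol
  obtain ⟨σ, C, hdom, him⟩ := exists_colourful_room hr c
  obtain ⟨j, hj, -⟩ := hdom hTne.some
  have hσ : σ.Nonempty := by
    rw [← Finset.image_nonempty (f := c), him]
    exact ⟨j, hj⟩
  have hmin : ∀ i, ∃ x ∈ σ, ∀ y ∈ σ, (x.1 i : ℕ) ≤ y.1 i := fun i =>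
    σ.exists_min_image (fun x => (x.1 i : ℕ)) hσ
  choose m hm hmle using hmin
  let M : ι → ℕ := fun i => ((m i).1 i : ℕ)
  have hCn : C.card ≤ n := Finset.card_le_univ C
  have hsumC : ∀ x ∈ σ, ∑ i ∈ C, M i ≤ ∑ i ∈ C, (x.1 i : ℕ) := fun x hx =>
    Finset.sum_le_sum fun i _ => hmle i x hx
  have hsplit : ∀ x : T, ∑ i ∈ C, (x.1 i : ℕ) + ∑ i ∈ Cᶜ, (x.1 i : ℕ) = N := fun x => by
    rw [Finset.sum_add_sum_compl]; exact x.2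
  -- Otherwise the minima over `C` could all be raised by one, with the remaining mass put at `j`,
  -- giving a grid point that violates dominance.
  have hlow : N < ∑ i ∈ C, M i + C.card := by
    by_contra! hle
    have hs : ∑ i ∈ C, (M i + 1) = ∑ i ∈ C, M i + C.card := by
      rw [Finset.sum_add_distrib]; simp
    obtain ⟨y, hy⟩ := mkT (fun i => (if i ∈ C then M i + 1 else 0) +
      if i = j then N - (∑ i ∈ C, M i + C.card) else 0) (by
        rw [Finset.sum_add_distrib, Finset.sum_ite_mem, Finset.univ_inter, hs]
        simp
        omega)
    obtain ⟨i, hi, h⟩ := hdom y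
    have h1 := hr_le i y (m i) (h _ (hm i))
    rw [hy] at h1
    simp only [hi, if_true] at h1
    simp only [M] at h1
    omega
  obtain ⟨x₀, hx₀⟩ := hσ
  have hMN : ∑ i ∈ C, M i ≤ N := by
    have := hsumC x₀ hx₀
    have := hsplit x₀
    omega
  -- The desired point is `W / N`. The slack put at `j` is less than `C.card ≤ n`, so `W` stays
  -- within `n` of every point of `σ`.
  let W : ι → ℕ := fun i => (if i ∈ C then M i else 0) +
    if i = j then N - ∑ i ∈ C, M i else 0
  have hWsum : ∑ i, W i = N := by
    simp only [W]
    rw [Finset.sum_add_distrib, Finset.sum_ite_mem, Finset.univ_inter]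
    simp
    omega
  have hWC : ∀ i, i ∉ C → W i = 0 := by
    intro i hi
    have : i ≠ j := fun h => hi (h ▸ hj)
    simp [W, hi, this]
  have hclose : ∀ x ∈ σ, ∀ i, W i ≤ (x.1 i : ℕ) + n ∧ (x.1 i : ℕ) ≤ W i + n := by
    intro x hx i
    have h1 := hsplit x
    by_cases hi : i ∈ C
    · have h2 : M i ≤ (x.1 i : ℕ) := hmle i x hx
      have h3 : ∑ k ∈ C.erase i, M k ≤ ∑ k ∈ C.erase i, (x.1 k : ℕ) :=
        Finset.sum_le_sum fun k _ => hmle k x hx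
      have h4 := Finset.add_sum_erase C M hi
      have h5 := Finset.add_sum_erase C (fun k => (x.1 k : ℕ)) hi
      have h6 : W i = M i + if i = j then N - ∑ i ∈ C, M i else 0 := by simp [W, hi]
      split_ifs at h6 <;> omega
    · rw [hWC i hi]
      have h2 : (x.1 i : ℕ) ≤ ∑ k ∈ Cᶜ, (x.1 k : ℕ) :=
        Finset.single_le_sum (f := fun k => (x.1 k : ℕ)) (fun _ _ => Nat.zero_le _) (by simpa)
      have h3 := hsumC x hx
      omega
  refine ⟨fun i => (W i : ℝ) / N, ⟨fun i => by positivity, ?_⟩, fun i hi => ?_⟩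
  · rw [← Finset.sum_div, div_eq_one_iff_eq hNpos.ne']
    exact_mod_cast hWsum
  · have hiC : i ∈ C := by
      by_contra h
      simp [hWC i h] at hi
    rw [← him] at hiC
    obtain ⟨x, hx, rfl⟩ := Finset.mem_image.1 hiC
    apply hc x
    rw [Metric.mem_ball, dist_pi_lt_iff hδ]
    intro k
    obtain ⟨h1, h2⟩ := hclose x hx k
    have h1' : (W k : ℝ) ≤ ((x.1 k : ℕ) : ℝ) + n := by exact_mod_cast h1
    have h2' : ((x.1 k : ℕ) : ℝ) ≤ W k + n := by exact_mod_cast h2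
    rw [Real.dist_eq, ← sub_div, abs_div, abs_of_pos hNpos, div_lt_iff₀ hNpos]
    refine lt_of_le_of_lt (abs_le.2 ⟨by linarith, by linarith⟩ : _ ≤ (n : ℝ)) ?_
    rw [div_lt_iff₀ hδ] at hN
    linarith

end GNKD

/-! ### Compactness of the price set, and separation from the cone. -/

namespace GNKD

variable {X : Type*} [AddCommGroup X] [Module ℝ X]

theorem continuous_pair_right (x : X) : Continuous fun p : AlgDual X => pair p x :=
  WeakBilin.eval_continuous (LinearMap.id : Module.Dual ℝ X →ₗ[ℝ] X →ₗ[ℝ] ℝ) x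

/-- A weak-* closed total subspace of the algebraic dual is the whole algebraic dual. -/
theorem eq_top_of_isClosed_of_isTotal (D : Submodule ℝ (AlgDual X))
    (hD : IsClosed (D : Set (AlgDual X))) (htot : IsTotal D) : D = ⊤ := by
  by_contra hne
  obtain ⟨f, hf⟩ : ∃ f, f ∉ D := by
    by_contra! h
    exact hne (eq_top_iff.2 fun f _ => h f)
  obtain ⟨g, u, hg, hu⟩ := geometric_hahn_banach_closed_point (D.convex) hD hf
  -- A linear functional bounded above on a subspace vanishes there. Weak-* continuous functionals
  -- are evaluations, so totality makes `g` zero.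
  have hg0 : ∀ p ∈ D, g p = 0 := by
    intro p hp
    by_contra hne
    have h := hg ((u / g p) • p) (D.smul_mem _ hp)
    rw [map_smul, smul_eq_mul, div_mul_cancel₀ _ hne] at h
    exact lt_irrefl _ h
  obtain ⟨x, rfl⟩ := LinearMap.dualEmbedding_surjective
    (LinearMap.id : Module.Dual ℝ X →ₗ[ℝ] X →ₗ[ℝ] ℝ) g
  have hev : ∀ p : AlgDual X, WeakBilin.eval
      (LinearMap.id : Module.Dual ℝ X →ₗ[ℝ] X →ₗ[ℝ] ℝ) x p = pair p x := fun p => rfl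
  have hx : x = 0 := by
    by_contra hx
    obtain ⟨p, hp, hpx⟩ := htot x 0 hx
    have := hg0 p hp
    rw [hev] at this
    exact hpx (this.trans (by simp [pair]))
  subst hx
  have h0 := hg 0 D.zero_mem
  simp only [map_zero] at h0 hu
  exact lt_asymm h0 hu

/-- This makes `v` an order unit: a price with value `-1` at `v` is at most `1 / t` at `x`, a bound
independent of the price. -/
theorem exists_pos_smul_mem {C : ConvexCone ℝ X} [TopologicalSpace X]
    [IsTopologicalAddGroup X] [ContinuousSMul ℝ X] {v : X} (hv : v ∈ interior (C : Set X))
    (x : X) : ∃ t : ℝ, 0 < t ∧ v + t • x ∈ C := by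
  have hc : ContinuousAt (fun t : ℝ => v + t • x) 0 := by fun_prop
  have h := hc.eventually (by simpa using isOpen_interior.mem_nhds hv :
    ∀ᶠ y in nhds (v + (0 : ℝ) • x), y ∈ interior (C : Set X))
  obtain ⟨t, ht, ht'⟩ := ((h.filter_mono nhdsWithin_le_nhds).and
    (self_mem_nhdsWithin : ∀ᶠ t in nhdsWithin (0 : ℝ) (Ioi 0), t ∈ Ioi 0)).exists
  exact ⟨t, ht', interior_subset ht⟩

theorem pair_add_smul (p : AlgDual X) (x y : X) (t : ℝ) :
    pair p (x + t • y) = pair p x + t * pair p y := by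
  simp [pair]

theorem pair_zero_left (x : X) : pair (0 : AlgDual X) x = 0 := rfl

theorem pair_neg_right (p : AlgDual X) (x : X) : pair p (-x) = -pair p x := by
  simp [pair]

theorem algDual_ext {p q : AlgDual X} (h : ∀ x, pair p x = pair q x) : p = q :=
  LinearMap.ext (f := (p : Module.Dual ℝ X)) (g := (q : Module.Dual ℝ X)) h

/-- As in Banach–Alaoglu: the order unit confines prices to a product of compact intervals, and the
linear functionals are closed in `X → ℝ`. -/
theorem isCompact_priceSet (D : Submodule ℝ (AlgDual X)) (hD : IsClosed (D : Set (AlgDual X)))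
    [TopologicalSpace X] [IsTopologicalAddGroup X] [ContinuousSMul ℝ X]
    (C : ConvexCone ℝ X) {v : X} (hv : v ∈ interior (C : Set X)) :
    IsCompact (priceSet D (C : Set X) v) := by
  have hemb : Topology.IsClosedEmbedding fun (p : AlgDual X) (x : X) => pair p x := by
    refine ⟨WeakBilin.isEmbedding (fun _ _ h => h), ?_⟩
    exact LinearMap.isClosed_range_coe X ℝ (RingHom.id ℝ)
  have hemb' := hemb.comp hD.isClosedEmbedding_subtypeVal
  choose t ht htC using exists_pos_smul_mem (C := C) hv
  have hbox : IsCompact (Set.univ.pi fun x : X => Icc (-(1 / t (-x))) (1 / t x)) :=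
    isCompact_univ_pi fun x => isCompact_Icc
  refine (hemb'.isCompact_preimage hbox).of_isClosed_subset ?_ ?_
  · have hcont : ∀ x : X, Continuous fun p : D => pair (p : AlgDual X) x := fun x =>
      (continuous_pair_right x).comp continuous_subtype_val
    have : priceSet D (C : Set X) v = (⋂ c ∈ C, {p : D | pair (p : AlgDual X) c ≤ 0}) ∩
        {p : D | pair (p : AlgDual X) v = -1} := by
      ext p
      simp [priceSet, polarCone]
    rw [this]
    exact (isClosed_biInter fun c _ => isClosed_le (hcont c) continuous_const).inter
      (isClosed_eq (hcont v) continuous_const)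
  · rintro p ⟨hp, hpv⟩ x -
    have key : ∀ y, pair (p : AlgDual X) y ≤ 1 / t y := by
      intro y
      have h := hp _ (htC y)
      rw [pair_add_smul, hpv] at h
      rw [le_div_iff₀ (ht y)]
      linarith
    refine ⟨?_, key x⟩
    have h := key (-x)
    rw [pair_neg_right] at h
    exact neg_le.1 h

/-- If `p` vanished at `v`, then `v + t • x ∈ C` would give `p · x ≤ 0` for every `x`, hence `p =
0`. -/
theorem pair_neg_of_mem_polarCone {D : Submodule ℝ (AlgDual X)}
    [TopologicalSpace X] [IsTopologicalAddGroup X] [ContinuousSMul ℝ X]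
    {C : ConvexCone ℝ X} {v : X} (hv : v ∈ interior (C : Set X)) {p : D}
    (hp : p ∈ polarCone D (C : Set X)) (hp0 : p ≠ 0) : pair (p : AlgDual X) v < 0 := by
  have hle := hp v (interior_subset hv)
  refine lt_of_le_of_ne hle fun h0 => hp0 ?_
  have key : ∀ x, pair (p : AlgDual X) x ≤ 0 := by
    intro x
    obtain ⟨t, ht, htC⟩ := exists_pos_smul_mem (C := C) hv x
    have h := hp _ htC
    rw [pair_add_smul, h0, zero_add] at h
    exact nonpos_of_mul_nonpos_right h ht
  refine Subtype.ext (algDual_ext fun x => ?_)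
  refine le_antisymm (key x) ?_
  have h := key (-x)
  rw [pair_neg_right] at h
  exact neg_nonpos.1 h

/-- A compact convex set disjoint from a closed convex cone with an interior point `v` is strictly
separated from it by a continuous functional normalised at `v`. -/
theorem exists_strongDual_pos_of_disjoint
    [TopologicalSpace X] [IsTopologicalAddGroup X] [ContinuousSMul ℝ X]
    {C : ConvexCone ℝ X} (hC : IsClosed (C : Set X)) {v : X} (hv : v ∈ interior (C : Set X))
    {K : Set X} (hK : IsCompact K) (hKc : Convex ℝ K) (hKne : K.Nonempty)
    (hdisj : Disjoint K (C : Set X)) :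
    ∃ f : X →L[ℝ] ℝ, (∀ c ∈ C, f c ≤ 0) ∧ f v = -1 ∧ ∀ z ∈ K, 0 < f z := by
  -- By compactness `K` can be pushed slightly along `v` without meeting `C`. Since `f v < 0`, this
  -- shift turns weak separation into strict positivity on `K`.
  have hev : ∀ᶠ t in nhds (0 : ℝ), ∀ z ∈ K, z + t • v ∉ (C : Set X) := by
    refine hK.eventually_forall_of_forall_eventually fun z hz => ?_
    have hc : ContinuousAt (fun q : ℝ × X => q.2 + q.1 • v) (0, z) := by fun_prop
    refine hc.eventually (hC.isOpen_compl.mem_nhds ?_)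
    simpa using Set.disjoint_left.1 hdisj hz
  obtain ⟨t, htK, ht⟩ := ((hev.filter_mono nhdsWithin_le_nhds).and
    (self_mem_nhdsWithin : ∀ᶠ t in nhdsWithin (0 : ℝ) (Ioi 0), t ∈ Ioi 0)).exists
  obtain ⟨f, u, hfC, hfK⟩ := geometric_hahn_banach_open (C.convex.interior) isOpen_interior
    (hKc.vadd (t • v)) (by
      rw [Set.disjoint_left]
      rintro _ hx ⟨z, hz, rfl⟩
      apply htK z hz
      have := interior_subset hx
      simpa [add_comm] using this)
  have hfK' : ∀ z ∈ K, u ≤ f z + t * f v := by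
    intro z hz
    have := hfK _ (Set.vadd_mem_vadd_set hz)
    simpa [add_comm] using this
  have hint : ∀ c ∈ C, ∀ s : ℝ, 0 < s → c + s • v ∈ interior (C : Set X) := by
    intro c hc s hs
    refine interior_maximal ?_ ((isOpen_interior.smul₀ hs.ne').vadd c)
      (Set.vadd_mem_vadd_set (Set.smul_mem_smul_set hv))
    rintro _ ⟨_, ⟨y, hy, rfl⟩, rfl⟩
    exact C.add_mem hc (C.smul_mem hs (interior_subset hy))
  have hfC' : ∀ c ∈ C, ∀ s : ℝ, 0 < s → f c + s * f v < u := by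
    intro c hc s hs
    simpa using hfC _ (hint c hc s hs)
  have hvC : v ∈ C := interior_subset hv
  have hscale : ∀ c ∈ C, f c ≤ 0 := by
    intro c hc
    by_contra! hpos
    have hpa : 0 < (|u| + |f v| + 1) / f c := by positivity
    have h := hfC' _ (C.smul_mem hpa hc) 1 one_pos
    rw [map_smul, smul_eq_mul, div_mul_cancel₀ _ hpos.ne'] at h
    have h1 := neg_abs_le (f v)
    have h2 := le_abs_self u
    linarith
  obtain ⟨z₀, hz₀⟩ := hKne
  -- If `f v = 0`, separation gives `f z₀ ≥ u > 0`, whereas `v + s • z₀ ∈ C` gives `f z₀ ≤ 0`.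
  have hfv : f v < 0 := by
    refine lt_of_le_of_ne (hscale v hvC) fun h0 => ?_
    have hu : 0 < u := by simpa [h0] using hfC' v hvC 1 one_pos
    have hz := hfK' z₀ hz₀
    obtain ⟨s, hs, hsC⟩ := exists_pos_smul_mem (C := C) hv z₀
    have h := hscale _ hsC
    rw [map_add, map_smul, h0, zero_add, smul_eq_mul] at h
    have := nonpos_of_mul_nonpos_right h hs
    rw [h0, mul_zero, add_zero] at hz
    linarith
  have hu : 0 ≤ u := by
    by_contra! hu
    -- With this `s`, the interior point `s • v + s • v` has value exactly `u`, contradicting the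
    -- strict bound.
    have hs : 0 < u / (2 * f v) := div_pos_of_neg_of_neg hu (by linarith)
    have h := hfC' _ (C.smul_mem hs hvC) _ hs
    rw [map_smul, smul_eq_mul] at h
    have h2 : u / (2 * f v) * f v + u / (2 * f v) * f v = u := by
      field_simp [hfv.ne]
      ring
    linarith
  refine ⟨(-f v)⁻¹ • f, fun c hc => ?_, ?_, fun z hz => ?_⟩
  · exact mul_nonpos_of_nonneg_of_nonpos (inv_nonneg.2 (neg_nonneg.2 hfv.le)) (hscale c hc)
  · have := hfv.ne
    simp only [FunLike.coe_smul, Pi.smul_apply, smul_eq_mul]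
    field_simp
  · have h1 := hfK' z hz
    have h2 : t * f v < 0 := mul_neg_of_pos_of_neg ht hfv
    have h3 : 0 < f z := by linarith
    exact mul_pos (inv_pos.2 (neg_pos.2 hfv)) h3

theorem nonempty_priceSet {D : Submodule ℝ (AlgDual X)}
    [TopologicalSpace X] [IsTopologicalAddGroup X] [ContinuousSMul ℝ X]
    {C : ConvexCone ℝ X} {v : X} (hv : v ∈ interior (C : Set X))
    (hpolar : polarCone D (C : Set X) ≠ {0}) : (priceSet D (C : Set X) v).Nonempty := by
  obtain ⟨p, hp, hp0⟩ : ∃ p ∈ polarCone D (C : Set X), p ≠ 0 := by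
    by_contra! h
    exact hpolar (Set.eq_singleton_iff_unique_mem.2 ⟨fun c _ => (pair_zero_left c).le, h⟩)
  have hneg := pair_neg_of_mem_polarCone hv hp hp0
  have hlin : ∀ (a : ℝ) (x : X), pair ((a • p : D) : AlgDual X) x =
    a * pair (p : AlgDual X) x := fun a x => rfl
  refine ⟨(-pair (p : AlgDual X) v)⁻¹ • p, fun c hc => ?_, ?_⟩
  · rw [hlin]
    exact mul_nonpos_of_nonneg_of_nonpos (inv_nonneg.2 (neg_nonneg.2 hneg.le)) (hp c hc)
  · rw [hlin]
    have := hneg.ne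
    field_simp

theorem pair_sum_smul {D : Submodule ℝ (AlgDual X)} {ι : Type*} [Fintype ι] (q : ι → D)
    (w : ι → ℝ) (x : X) : pair ((∑ i, w i • q i : D) : AlgDual X) x =
      ∑ i, w i * pair (q i : AlgDual X) x := by
  let ev : D →ₗ[ℝ] ℝ :=
    { toFun := fun p => pair (p : AlgDual X) x
      map_add' := fun _ _ => rfl
      map_smul' := fun _ _ => rfl }
  change ev _ = ∑ i, w i * ev (q i)
  simp only [map_sum, map_smul, smul_eq_mul]

theorem sum_smul_mem_priceSet {D : Submodule ℝ (AlgDual X)} {C : Set X} {v : X} {ι : Type*}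
    [Fintype ι] {q : ι → D} {w : ι → ℝ} (hw : w ∈ stdSimplex ℝ ι)
    (hq : ∀ i, q i ∈ priceSet D C v) : ∑ i, w i • q i ∈ priceSet D C v := by
  refine ⟨fun c hc => ?_, ?_⟩
  · rw [pair_sum_smul]
    exact Finset.sum_nonpos fun i _ => mul_nonpos_of_nonneg_of_nonpos (hw.1 i) ((hq i).1 c hc)
  · rw [pair_sum_smul]
    simp only [(hq _).2, mul_neg_one, Finset.sum_neg_distrib, hw.2]

theorem continuous_sum_smul {D : Submodule ℝ (AlgDual X)} {ι : Type*} [Fintype ι] (q : ι → D) :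
    Continuous fun w : ι → ℝ => ∑ i, w i • q i := by
  refine continuous_induced_rng.2 (WeakBilin.continuous_of_continuous_eval _ fun x => ?_)
  change Continuous fun w : ι → ℝ => pair ((∑ i, w i • q i : D) : AlgDual X) x
  simp only [pair_sum_smul]
  fun_prop

/-- In a closed total subspace of the dual, some price is positive on a given nonempty compact
convex set that is disjoint from the cone. -/
theorem exists_mem_priceSet_pos_of_disjoint {D : Submodule ℝ (AlgDual X)}
    (hD : IsClosed (D : Set (AlgDual X))) (htot : IsTotal D)
    [TopologicalSpace X] [IsTopologicalAddGroup X] [ContinuousSMul ℝ X]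
    {C : ConvexCone ℝ X} (hC : IsClosed (C : Set X)) {v : X} (hv : v ∈ interior (C : Set X))
    {K : Set X} (hK : IsCompact K) (hKc : Convex ℝ K) (hKne : K.Nonempty)
    (hdisj : Disjoint K (C : Set X)) :
    ∃ (q : priceSet D (C : Set X) v) (f : X →L[ℝ] ℝ),
      (∀ x, pair ((q : D) : AlgDual X) x = f x) ∧ f ≠ 0 ∧ ∀ z ∈ K, 0 < f z := by
  obtain ⟨f, hfC, hfv, hfp⟩ := exists_strongDual_pos_of_disjoint hC hv hK hKc hKne hdisj
  obtain ⟨g, hg⟩ : ∃ g : AlgDual X, ∀ x, pair g x = f x :=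
    ⟨(show Module.Dual ℝ X from f.toLinearMap), fun x => rfl⟩
  have hgD : g ∈ D := eq_top_of_isClosed_of_isTotal D hD htot ▸ Submodule.mem_top
  refine ⟨⟨⟨g, hgD⟩, fun c hc => (hg c).trans_le (hfC c hc), (hg v).trans hfv⟩, f, hg, ?_, hfp⟩
  rintro rfl
  simp at hfv

end GNKD

/-! ### The equilibrium price. -/

theorem mainTheorem1 {X : Type*} [AddCommGroup X] [Module ℝ X] [TopologicalSpace X]
    [IsTopologicalAddGroup X] [ContinuousSMul ℝ X] [T2Space X]
    (hX : ∀ x y : X, x ≠ y → ∃ f : GNKD.AlgDual X, GNKD.pair f x ≠ GNKD.pair f y)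
    (D : Submodule ℝ (GNKD.AlgDual X))
    (hDclosed : IsClosed (D : Set (GNKD.AlgDual X)))
    (hDtotal : GNKD.IsTotal D)
    (C : ConvexCone ℝ X)
    (hCclosed : IsClosed (C : Set X))
    (hCne : (C : Set X) ≠ Set.univ)
    (v : X) (hv : v ∈ interior (C : Set X))
    (hpolar : GNKD.polarCone D (C : Set X) ≠ {0})
    (ξ : GNKD.priceSet D (C : Set X) v → Set X)
    (hξ : GNKD.UpperDemicontinuous ξ)
    (hξne : ∀ p, (ξ p).Nonempty)
    (hξcompact : ∀ p, IsCompact (ξ p))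
    (hξconvex : ∀ p, Convex ℝ (ξ p))
    (hWalras : ∀ p : GNKD.priceSet D (C : Set X) v,
      ∃ z ∈ ξ p, GNKD.pair ((p : D) : GNKD.AlgDual X) z ≤ 0) :
    ∃ p : GNKD.priceSet D (C : Set X) v, (ξ p ∩ (C : Set X)).Nonempty := by
  classical
  open GNKD in
  by_contra! hcon
  have hcompact : CompactSpace (priceSet D (C : Set X) v) :=
    isCompact_iff_compactSpace.1 (isCompact_priceSet D hDclosed C hv)
  have hsep := fun p => exists_mem_priceSet_pos_of_disjoint hDclosed hDtotal hCclosed hv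
    (hξcompact p) (hξconvex p) (hξne p) (Set.disjoint_iff_inter_eq_empty.2 (hcon p))
  choose q f hqf hf0 hfpos using hsep
  let V : priceSet D (C : Set X) v → Set (priceSet D (C : Set X) v) := fun p =>
    {s | ξ s ⊆ {y | 0 < f p y}}
  have hVopen : ∀ p, IsOpen (V p) := fun p => hξ _ ⟨f p, 0, hf0 p, rfl⟩
  obtain ⟨t, ht⟩ := isCompact_univ.elim_finite_subcover V hVopen
    (fun p _ => Set.mem_iUnion.2 ⟨p, hfpos p⟩)
  have hne : Nonempty t := by
    obtain ⟨p, hp⟩ := nonempty_priceSet hv hpolar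
    obtain ⟨i, hi, -⟩ := Set.mem_iUnion₂.1 (ht (Set.mem_univ ⟨p, hp⟩))
    exact ⟨⟨i, hi⟩⟩
  have hmem : ∀ w ∈ stdSimplex ℝ t, ∑ i, w i • (q i : D) ∈ priceSet D (C : Set X) v :=
    fun w hw => sum_smul_mem_priceSet hw fun i => (q i).2
  have hcont := continuous_sum_smul fun i : t => (q i : D)
  -- The combination `∑ w i • q i` is known to be a price only for `w` in the simplex, so the cover
  -- is extended to open sets of `D` before being pulled back.
  have hO : ∀ i : t, ∃ O : Set D, IsOpen O ∧ Subtype.val ⁻¹' O = V i := fun i =>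
    isOpen_induced_iff.1 (hVopen i)
  choose O hOopen hOV using hO
  obtain ⟨w, hw, hwO⟩ := exists_mem_stdSimplex_of_open_cover
    (fun i => (fun w : t → ℝ => ∑ i, w i • (q i : D)) ⁻¹' O i)
    (fun i => (hOopen i).preimage hcont) (by
      intro w hw
      obtain ⟨i, hi, hiV⟩ := Set.mem_iUnion₂.1 (ht (Set.mem_univ ⟨_, hmem w hw⟩))
      rw [← hOV ⟨i, hi⟩] at hiV
      exact Set.mem_iUnion.2 ⟨⟨i, hi⟩, hiV⟩)
  obtain ⟨z, hz, hzle⟩ := hWalras ⟨_, hmem w hw⟩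
  rw [pair_sum_smul] at hzle
  simp only [hqf] at hzle
  have hpos : ∀ i, w i ≠ 0 → 0 < f i z := by
    intro i hi
    have h : (⟨_, hmem w hw⟩ : priceSet D (C : Set X) v) ∈ V i := by
      rw [← hOV i]
      exact hwO i hi
    exact h hz
  have hnn : ∀ i, 0 ≤ w i * f i z := by
    intro i
    by_cases hi : w i = 0
    · simp [hi]
    · exact mul_nonneg (hw.1 i) (hpos i hi).le
  have hzero := (Finset.sum_eq_zero_iff_of_nonneg fun i _ => hnn i).1
    (le_antisymm hzle (Finset.sum_nonneg fun i _ => hnn i))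
  have hw0 : ∀ i, w i = 0 := by
    intro i
    by_contra hi
    exact (mul_ne_zero hi (hpos i hi).ne') (hzero i (Finset.mem_univ i))
  have := hw.2
  simp [hw0] at this
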